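/- All graphs are finite and simple. For natural numbers $n,k,g,\lambda$, an $egr(n,k,g,\lambda)$ graph is a $k$-regular graph of order $n$ and girth $g$ each of whose edges is contained in exactly $\lambda$ distinct cycles of length $g$. Let $n(k,g,\lambda)$ (respectively $n_2(k,g,\lambda)$) be the smallest order of an $egr(n,k,g,\lambda)$ graph (respectively of a bipartite one), over all $n$ for which such a graph exists. Let $G$ be an $egr(n,k,g,\lambda)$ graph with $g$ even, let $v$ be any vertex of $G$, and let $c(\ell,k)$ denote the number of closed walks of length $\ell$ in $G$ starting at $v$ that contain no cycle, i.e. whose edges form an acyclic graph. If $g\equiv 0 \pmod 4$, then $c(g,k)-c(\frac g2,k)^2+k\lambda>0$ and $$n(k,g,\lambda)\ \ge\ \frac{c(g,k)+k\lambda+k^{g}-2c(\frac g2,k)k^{g/2}}{c(g,k)-c(\frac g2,k)^2+k\lambda},$$ and, if a bipartite edge-girth-regular graph with parameters $k,g,\lambda$ exists, $$n_2(k,g,\lambda)\ \ge\ 2\,\frac{c(g,k)+k\lambda+k^{g}-2c(\frac g2,k)k^{g/2}}{c(g,k)-c(\frac g2,k)^2+k\lambda}.$$ If $g\equiv 2 \pmod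 4$, then $c(g,k)+k\lambda>0$ and $$n(k,g,\lambda)\ \ge\ \frac{c(g,k)+k\lambda+k^g}{c(g,k)+k\lambda},$$ and, if a bipartite edge-girth-regular graph with parameters $k,g,\lambda$ exists, $$n_2(k,g,\lambda)\ \ge\ \frac{2k^g}{c(g,k)+k\lambda}.$$ -/

import Mathlib

universe u

namespace EdgeGirthRegular

variable {V : Type u}

/-- `H` is a cycle of length `g` in `G`, regarded as a subgraph (so that the base point and the
orientation of a closed walk running around it do not matter). -/
def IsCycleSubgraph (G : SimpleGraph V) (g : ℕ) (H : G.Subgraph) : Prop :=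
  ∃ (v : V) (p : G.Walk v v), p.IsCycle ∧ p.length = g ∧ p.toSubgraph = H

/-- `G` is an edge-girth-regular graph `egr(n, k, g, lam)`: it has order `n`, it is `k`-regular, it
has girth `g`, and each of its edges lies in exactly `lam` distinct cycles of length `g`.
The extended girth of a forest is `⊤`, so such a graph has a cycle. -/
structure IsEGR [Fintype V] (G : SimpleGraph V) [DecidableRel G.Adj] (n k g lam : ℕ) : Prop where
  order : Fintype.card V = n
  regular : G.IsRegularOfDegree k
  girth : G.egirth = (g : ℕ∞)
  cycles : ∀ e ∈ G.edgeSet, {H : G.Subgraph | IsCycleSubgraph G g H ∧ e ∈ H.edgeSet}.ncard = lam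

/-- The set of orders of the graphs `egr(n, k, g, lam)`. -/
def orders (k g lam : ℕ) : Set ℕ :=
  {n | ∃ (G : SimpleGraph (Fin n)) (_ : DecidableRel G.Adj), IsEGR G n k g lam}

/-- The set of orders of the bipartite graphs `egr(n, k, g, lam)`. -/
def bipartiteOrders (k g lam : ℕ) : Set ℕ :=
  {n | ∃ (G : SimpleGraph (Fin n)) (_ : DecidableRel G.Adj), IsEGR G n k g lam ∧ G.IsBipartite}

/-- `n(k, g, lam)`: the smallest order of an edge-girth-regular graph with parameters `k, g, lam`
(meaningful when such a graph exists). -/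
noncomputable def minOrder (k g lam : ℕ) : ℕ := sInf (orders k g lam)

/-- `n₂(k, g, lam)`: the smallest order of a bipartite edge-girth-regular graph with parameters
`k, g, lam` (meaningful when such a graph exists). -/
noncomputable def minBipartiteOrder (k g lam : ℕ) : ℕ := sInf (bipartiteOrders k g lam)

/-- The number of closed walks of length `l` starting at `v` that contain no cycle, i.e. whose
edges form an acyclic graph. -/
noncomputable def c (G : SimpleGraph V) (v : V) (l : ℕ) : ℕ :=
  {p : G.Walk v v | p.length = l ∧ (SimpleGraph.fromEdgeSet {e | e ∈ p.edges}).IsAcyclic}.ncard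

end EdgeGirthRegular

/-!
Let `A` be the adjacency matrix and `g = 2l`. The entries of the row of `A ^ l` at a vertex `v` sum
to `k ^ l`, and their squares sum to the number `C` of closed walks of length `g` at `v`. A closed
walk of length at most `g` that contains a cycle runs once around a cycle of length `g`, so
`C = c(g, k) + kλ` and the diagonal entry of the row is `c(l, k)`. The Cauchy–Schwarz inequality for
the rest of the row gives `(k ^ l - c(l, k)) ^ 2 ≤ (n - 1) (C - c(l, k) ^ 2)`, which is the bound on
`n`; in a bipartite graph the row is supported on one colour class, so `n` may be replaced by
`n / 2`, except that for odd `l`, where `c(l, k) = 0`, it is the class not containing `v` and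
`n - 1` becomes `n / 2`. The left side of the inequality is positive because the last step of a
closed walk is forced, whence `C - c(l, k) ^ 2 > 0`.

That `c(l, k)` depends only on `k` follows from the expansion of `A ^ l` in the matrices `N j`
counting non-backtracking walks, whose coefficients count walks in the `k`-regular tree: on the
diagonal, `N j` vanishes for `0 < j < g`, and for `j = g` it counts cycles.
-/

namespace EdgeGirthRegular

open SimpleGraph Finset

section Walk

variable {V : Type*} {G : SimpleGraph V}

theorem isAcyclic_fromEdgeSet_of_card_lt_egirth {s : Finset (Sym2 V)}
    (hs : (s : Set (Sym2 V)) ⊆ G.edgeSet) (hcard : (#s : ℕ∞) < G.egirth) :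
    (fromEdgeSet (s : Set (Sym2 V))).IsAcyclic := by
  classical
  intro v p hp
  have hle : fromEdgeSet (s : Set (Sym2 V)) ≤ G := by
    rw [← fromEdgeSet_edgeSet G]
    exact fromEdgeSet_mono hs
  have hlen : p.length ≤ #s := by
    rw [← p.length_edges, ← List.toFinset_card_of_nodup hp.isTrail.edges_nodup]
    refine card_le_card fun e he => ?_
    have := p.edges_subset_edgeSet (List.mem_toFinset.1 he)
    exact (edgeSet_fromEdgeSet (s : Set (Sym2 V)) ▸ this).1
  have hgirth : G.egirth ≤ p.length := by
    simpa using egirth_le_length (hp.mapLe hle)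
  exact absurd hcard (not_lt.2 (hgirth.trans (by exact_mod_cast hlen)))

theorem egirth_le_card_edges_of_not_isAcyclic [DecidableEq V] {u v : V} {p : G.Walk u v}
    (hp : ¬ (fromEdgeSet {e | e ∈ p.edges}).IsAcyclic) : G.egirth ≤ #p.edges.toFinset := by
  refine not_lt.1 fun hlt => hp ?_
  rw [← List.coe_toFinset]
  refine isAcyclic_fromEdgeSet_of_card_lt_egirth (fun e he => ?_) hlt
  exact p.edges_subset_edgeSet (List.mem_toFinset.1 he)

theorem isAcyclic_edges_of_length_lt_egirth {u v : V} {p : G.Walk u v}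
    (hp : (p.length : ℕ∞) < G.egirth) : (fromEdgeSet {e | e ∈ p.edges}).IsAcyclic := by
  classical
  by_contra hcyc
  have hcard : #p.edges.toFinset ≤ p.length := p.length_edges ▸ p.edges.toFinset_card_le
  exact hp.not_ge ((egirth_le_card_edges_of_not_isAcyclic hcyc).trans (by exact_mod_cast hcard))

theorem mem_edgeSet_fromEdgeSet_edges {u v : V} {p : G.Walk u v} {e : Sym2 V}
    (he : e ∈ p.edges) : e ∈ (fromEdgeSet {e | e ∈ p.edges}).edgeSet := by
  rw [edgeSet_fromEdgeSet]
  exact ⟨he, G.not_isDiag_of_mem_edgeSet (p.edges_subset_edgeSet he)⟩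

/-- A walk is non-backtracking if no two of its consecutive edges coincide. For a closed walk,
the first and the last edge are not compared. -/
def IsNonBacktracking {u v : V} (p : G.Walk u v) : Prop :=
  p.edges.IsChain (· ≠ ·)

theorem IsNonBacktracking.isPath {u v : V} {p : G.Walk u v} (hp : IsNonBacktracking p)
    (hacyc : (fromEdgeSet {e | e ∈ p.edges}).IsAcyclic) : p.IsPath := by
  have hmem : ∀ e ∈ p.edges, e ∈ (fromEdgeSet {e | e ∈ p.edges}).edgeSet :=
    fun _ => mem_edgeSet_fromEdgeSet_edges
  have hchain : (p.transfer _ hmem).edges.IsChain (· ≠ ·) := by rwa [Walk.edges_transfer]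
  have hpath := (hacyc.isPath_iff_isChain _).2 hchain
  rwa [Walk.isPath_def, Walk.support_transfer, ← Walk.isPath_def] at hpath

/-- A closed walk that contains a cycle has at least `G.egirth` distinct edges, so if it is no
longer than that it is a trail; its tail, being shorter than any cycle, is then a path. -/
theorem isCycle_of_not_isAcyclic {v : V} {p : G.Walk v v} (hlen : (p.length : ℕ∞) ≤ G.egirth)
    (hp : ¬ (fromEdgeSet {e | e ∈ p.edges}).IsAcyclic) : p.IsCycle := by
  classical
  have hcard : p.edges.length ≤ #p.edges.toFinset := by
    rw [p.length_edges]
    exact_mod_cast hlen.trans (egirth_le_card_edges_of_not_isAcyclic hp)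
  have htrail : p.edges.Nodup :=
    Multiset.toFinset_card_eq_card_iff_nodup.1 (hcard.antisymm' (List.toFinset_card_le _))
  cases p with
  | nil => simp at hp
  | cons h p =>
    rw [Walk.edges_cons, List.nodup_cons] at htrail
    have hlt : (p.length : ℕ∞) < G.egirth :=
      lt_of_lt_of_le (by exact_mod_cast p.length.lt_succ_self) hlen
    have hnb : IsNonBacktracking p := htrail.2.isChain
    exact (Walk.cons_isCycle_iff _ _).2
      ⟨hnb.isPath (isAcyclic_edges_of_length_lt_egirth hlt), htrail.1⟩

theorem isCycle_iff_not_isAcyclic {v : V} {p : G.Walk v v}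
    (hlen : (p.length : ℕ∞) ≤ G.egirth) :
    p.IsCycle ↔ ¬ (fromEdgeSet {e | e ∈ p.edges}).IsAcyclic :=
  ⟨fun hp hacyc => hacyc _ (hp.transfer fun _ => mem_edgeSet_fromEdgeSet_edges),
    isCycle_of_not_isAcyclic hlen⟩

theorem isNonBacktracking_iff_isCycle {v : V} {p : G.Walk v v}
    (hlen : (p.length : ℕ∞) ≤ G.egirth) (hnil : ¬ p.Nil) : IsNonBacktracking p ↔ p.IsCycle :=
  ⟨fun hp => isCycle_of_not_isAcyclic hlen fun hacyc =>
    hnil (Walk.isPath_iff_nil.1 (hp.isPath hacyc)), fun hp => hp.isTrail.edges_nodup.isChain⟩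

theorem eq_of_isPath_of_edges_subset {u v : V} {p q : G.Walk u v} (hp : p.IsPath) (hq : q.IsPath)
    (hsub : ∀ e ∈ q.edges, e ∈ p.edges) : q = p := by
  induction p with
  | nil => exact Walk.eq_nil_iff_nil.2 (Walk.isPath_iff_nil.1 hq)
  | @cons u x v h p ih =>
    rw [Walk.cons_isPath_iff] at hp
    cases q with
    | nil => exact absurd p.end_mem_support hp.2
    | @cons _ y _ h' q =>
      rw [Walk.cons_isPath_iff] at hq
      simp only [Walk.edges_cons, List.mem_cons, forall_eq_or_imp] at hsub
      obtain rfl : y = x := hsub.1.elim Sym2.congr_right.1 fun he =>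
        absurd (p.fst_mem_support_of_mem_edges he) hp.2
      rw [ih hp.1 hq.1 fun e he => (hsub.2 e he).resolve_left ?_]
      rintro rfl
      exact hq.2 (q.fst_mem_support_of_mem_edges he)

theorem IsCycleSubgraph.exists_isCycle_cons {v x : V} (h : G.Adj v x) {l : ℕ} {H : G.Subgraph}
    (hH : IsCycleSubgraph G (l + 1) H) (hvx : s(v, x) ∈ H.edgeSet) :
    ∃ p : G.Walk x v, p.length = l ∧ (Walk.cons h p).IsCycle ∧
      (Walk.cons h p).toSubgraph = H := by
  classical
  obtain ⟨u, q, hq, hlen, rfl⟩ := hH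
  have hv : v ∈ q.support :=
    q.fst_mem_support_of_mem_edges ((Walk.mem_edges_toSubgraph q).1 hvx)
  obtain ⟨r, hr, hrlen, hrq, hrx⟩ : ∃ r : G.Walk v v,
      r.IsCycle ∧ r.length = l + 1 ∧ r.toSubgraph = q.toSubgraph ∧ r.snd = x := by
    have hrot := hq.rotate hv
    have hrotq := q.toSubgraph_rotate hv
    have hx : x ∈ (q.rotate v hv).toSubgraph.neighborSet v := hrotq ▸ hvx
    rw [hrot.neighborSet_toSubgraph_endpoint] at hx
    rcases hx with rfl | rfl
    · exact ⟨_, hrot, by rw [Walk.length_rotate, hlen], hrotq, rfl⟩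
    · exact ⟨_, hrot.reverse, by rw [Walk.length_reverse, Walk.length_rotate, hlen],
        by rw [Walk.toSubgraph_reverse, hrotq], Walk.snd_reverse _⟩
  cases r with
  | nil => exact absurd hr Walk.not_isCycle_nil
  | cons h' p =>
    rw [Walk.snd_cons] at hrx
    subst hrx
    exact ⟨p, Nat.succ_injective hrlen, hr, hrq⟩

theorem ncard_isCycle_cons {v x : V} (h : G.Adj v x) (l : ℕ) :
    {p : G.Walk x v | p.length = l ∧ (Walk.cons h p).IsCycle}.ncard =
      {H : G.Subgraph | IsCycleSubgraph G (l + 1) H ∧ s(v, x) ∈ H.edgeSet}.ncard := by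
  refine Set.ncard_congr (fun p _ => (Walk.cons h p).toSubgraph) ?_ ?_ ?_
  · rintro p ⟨rfl, hp⟩
    exact ⟨⟨v, _, hp, rfl, rfl⟩, (Walk.mem_edges_toSubgraph _).2 (List.mem_cons_self ..)⟩
  · rintro p q ⟨-, hp⟩ ⟨-, hq⟩ heq
    rw [Walk.cons_isCycle_iff] at hp hq
    refine (eq_of_isPath_of_edges_subset hp.1 hq.1 fun e he => ?_).symm
    have hmem : e ∈ (Walk.cons h p).edges := by
      rw [← Walk.mem_edges_toSubgraph, heq, Walk.mem_edges_toSubgraph]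
      exact List.mem_cons_of_mem _ he
    refine (List.mem_cons.1 hmem).resolve_left ?_
    rintro rfl
    exact hq.2 he
  · rintro H ⟨hH, hvx⟩
    obtain ⟨p, hlen, hp, rfl⟩ := hH.exists_isCycle_cons h hvx
    exact ⟨p, ⟨hlen, hp⟩, rfl⟩

end Walk

section NonBacktracking

variable {V : Type*} {G : SimpleGraph V}

/-- The matrix whose entry at `(u, v)` is the number of non-backtracking walks of length `j` from
`u` to `v`. -/
noncomputable def nbMatrix (G : SimpleGraph V) (j : ℕ) : Matrix V V ℕ :=
  Matrix.of fun u v => {p : G.Walk u v | p.length = j ∧ IsNonBacktracking p}.ncard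

/-- The number of walks of length `j` from `w` to `v` which remain non-backtracking when they are
preceded by the step from `u` to `w`. -/
noncomputable def nbExtensionCount (G : SimpleGraph V) (j : ℕ) (u w v : V) : ℕ :=
  {p : G.Walk w v | p.length = j ∧ (s(u, w) :: p.edges).IsChain (· ≠ ·)}.ncard

theorem nbExtensionCount_zero (u w v : V) : nbExtensionCount G 0 u w v = nbMatrix G 0 w v := by
  refine congrArg Set.ncard (Set.ext fun p => and_congr_right fun hp => ?_)
  have hnil : p.edges = [] := List.eq_nil_of_length_eq_zero (by rw [p.length_edges, hp])
  simp [IsNonBacktracking, hnil]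

theorem nbMatrix_zero [DecidableEq V] : nbMatrix G 0 = 1 := by
  ext u v
  obtain rfl | huv := eq_or_ne u v
  · rw [Matrix.one_apply_eq]
    exact Set.ncard_eq_one.2 ⟨Walk.nil, Set.eq_singleton_iff_unique_mem.2 ⟨⟨rfl, List.isChain_nil⟩,
      fun _ hp => Walk.eq_nil_iff_nil.2 (Walk.length_eq_zero_iff.1 hp.1)⟩⟩
  · have hempty : {p : G.Walk u v | p.length = 0 ∧ IsNonBacktracking p} = ∅ :=
      Set.eq_empty_of_forall_notMem fun p hp => huv (Walk.eq_of_length_eq_zero hp.1)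
    rw [Matrix.one_apply_ne huv, nbMatrix, Matrix.of_apply, hempty, Set.ncard_empty]

theorem finite_setOf_length_eq [G.LocallyFinite] (u v : V) (l : ℕ) :
    {p : G.Walk u v | p.length = l}.Finite := by
  classical
  exact Set.toFinite _

theorem ncard_walk_succ [G.LocallyFinite] {u v : V} (l : ℕ) {P : G.Walk u v → Prop} {f : V → ℕ}
    (hf : ∀ x (h : G.Adj u x), {p : G.Walk x v | p.length = l ∧ P (p.cons h)}.ncard = f x) :
    {p : G.Walk u v | p.length = l + 1 ∧ P p}.ncard = ∑ x ∈ G.neighborFinset u, f x := by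
  have hfin (x : G.neighborSet u) : Finite {p : G.Walk x v | p.length = l ∧ P (p.cons x.2)} :=
    ((finite_setOf_length_eq x.1 v l).subset fun _ hp => hp.1).to_subtype
  let consEquiv : (Σ x : G.neighborSet u, {p : G.Walk x v | p.length = l ∧ P (p.cons x.2)}) →
      {p : G.Walk u v | p.length = l + 1 ∧ P p} := fun y =>
    ⟨y.2.1.cons y.1.2, congrArg Nat.succ y.2.2.1, y.2.2.2⟩
  have hbij : Function.Bijective consEquiv := by
    constructor
    · rintro ⟨⟨x, hx⟩, p, hp⟩ ⟨⟨y, hy⟩, q, hq⟩ heq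
      obtain ⟨rfl, hpq⟩ := Walk.cons.inj (congrArg Subtype.val heq)
      obtain rfl := eq_of_heq hpq
      rfl
    · rintro ⟨p, hl, hp⟩
      cases p with
      | nil => exact absurd hl (Nat.succ_ne_zero l).symm
      | @cons _ x _ h p => exact ⟨⟨⟨x, h⟩, p, Nat.succ_injective hl, hp⟩, rfl⟩
  calc {p : G.Walk u v | p.length = l + 1 ∧ P p}.ncard
      = ∑ x : G.neighborSet u, {p : G.Walk x v | p.length = l ∧ P (p.cons x.2)}.ncard := by
        simp only [← Nat.card_coe_set_eq]
        rw [← Nat.card_sigma, Nat.card_congr (Equiv.ofBijective consEquiv hbij)]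
    _ = ∑ x : G.neighborSet u, f x := sum_congr rfl fun x _ => hf x x.2
    _ = ∑ x ∈ G.neighborFinset u, f x :=
        (sum_subtype _ (fun x => G.mem_neighborFinset u x) f).symm

theorem nbMatrix_succ_apply [G.LocallyFinite] (j : ℕ) (u v : V) :
    nbMatrix G (j + 1) u v = ∑ w ∈ G.neighborFinset u, nbExtensionCount G j u w v :=
  ncard_walk_succ j fun _ _ => rfl

theorem nbExtensionCount_succ_add [G.LocallyFinite] {u w : V} (h : G.Adj u w) (j : ℕ) (v : V) :
    nbExtensionCount G (j + 1) u w v + nbExtensionCount G j w u v = nbMatrix G (j + 1) w v := by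
  classical
  have hu : u ∈ G.neighborFinset w := (G.mem_neighborFinset w u).2 h.symm
  have hstep : nbExtensionCount G (j + 1) u w v =
      ∑ x ∈ G.neighborFinset w, if x = u then 0 else nbExtensionCount G j w x v := by
    refine ncard_walk_succ j fun x hx => ?_
    split_ifs with hxu
    · subst hxu
      simp [Sym2.eq_swap]
    · have hne : s(u, w) ≠ s(w, x) := fun heq =>
        hxu (Sym2.congr_right.1 (Sym2.eq_swap.trans heq)).symm
      simp only [Walk.edges_cons, List.isChain_cons_cons, ne_eq, hne, not_false_eq_true, true_and,
        nbExtensionCount]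
  rw [hstep, nbMatrix_succ_apply, ← sum_erase_add _ _ hu, ← sum_erase_add _ _ hu, if_pos rfl,
    add_zero, sum_congr rfl fun x hx => if_neg (ne_of_mem_erase hx)]

variable [Fintype V] [DecidableRel G.Adj] {k : ℕ}

theorem adjMatrix_mul_nbMatrix_zero : G.adjMatrix ℕ * nbMatrix G 0 = nbMatrix G 1 := by
  ext u v
  rw [adjMatrix_mul_apply, nbMatrix_succ_apply]
  exact sum_congr rfl fun w _ => (nbExtensionCount_zero u w v).symm

theorem adjMatrix_mul_nbMatrix_succ_apply (j : ℕ) (u v : V) :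
    (G.adjMatrix ℕ * nbMatrix G (j + 1)) u v =
      nbMatrix G (j + 2) u v + ∑ w ∈ G.neighborFinset u, nbExtensionCount G j w u v := by
  rw [adjMatrix_mul_apply, nbMatrix_succ_apply, ← sum_add_distrib]
  exact sum_congr rfl fun w hw =>
    (nbExtensionCount_succ_add ((G.mem_neighborFinset u w).1 hw) j v).symm

theorem sum_nbExtensionCount_succ_add (hk : G.IsRegularOfDegree k) (j : ℕ) (u v : V) :
    ∑ w ∈ G.neighborFinset u, nbExtensionCount G (j + 1) w u v + nbMatrix G (j + 1) u v =
      k * nbMatrix G (j + 1) u v := by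
  nth_rw 1 [nbMatrix_succ_apply]
  rw [← sum_add_distrib, sum_congr rfl fun w hw =>
    nbExtensionCount_succ_add ((G.mem_neighborFinset u w).1 hw).symm j v,
    sum_const, card_neighborFinset_eq_degree, hk u, smul_eq_mul]

theorem adjMatrix_mul_nbMatrix_one (hk : G.IsRegularOfDegree k) :
    G.adjMatrix ℕ * nbMatrix G 1 = nbMatrix G 2 + k • nbMatrix G 0 := by
  ext u v
  rw [adjMatrix_mul_nbMatrix_succ_apply, Matrix.add_apply, Matrix.smul_apply]
  simp only [nbExtensionCount_zero, sum_const, card_neighborFinset_eq_degree, hk u]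

theorem adjMatrix_mul_nbMatrix_add_two (hk : G.IsRegularOfDegree k) (j : ℕ) :
    G.adjMatrix ℕ * nbMatrix G (j + 2) = nbMatrix G (j + 3) + (k - 1) • nbMatrix G (j + 1) := by
  ext u v
  rw [adjMatrix_mul_nbMatrix_succ_apply, Matrix.add_apply, Matrix.smul_apply, smul_eq_mul,
    Nat.sub_one_mul, ← sum_nbExtensionCount_succ_add hk, Nat.add_sub_cancel]

end NonBacktracking

section TreeWalkCount

/-- The number of walks of length `i` between two given vertices at distance `j` in the infinite
`k`-regular tree, computed by looking at the first step: one neighbour of the starting point is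
closer to the target and the other `k - 1` are farther away. -/
def treeWalkCount (k : ℕ) : ℕ → ℕ → ℕ
  | 0, 0 => 1
  | 0, _ + 1 => 0
  | i + 1, 0 => k * treeWalkCount k i 1
  | i + 1, j + 1 => treeWalkCount k i j + (k - 1) * treeWalkCount k i (j + 2)

theorem treeWalkCount_eq_zero_of_lt (k : ℕ) {i j : ℕ} (hij : i < j) :
    treeWalkCount k i j = 0 := by
  induction i generalizing j with
  | zero => obtain ⟨j, rfl⟩ := Nat.exists_eq_add_one.2 hij; rfl
  | succ i ih =>
    obtain ⟨j, rfl⟩ := Nat.exists_eq_add_one.2 (i.succ_pos.trans hij)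
    rw [treeWalkCount, ih (by omega), ih (by omega), mul_zero, add_zero]

theorem treeWalkCount_self (k i : ℕ) : treeWalkCount k i i = 1 := by
  induction i with
  | zero => rfl
  | succ i ih =>
    rw [treeWalkCount, ih, treeWalkCount_eq_zero_of_lt k (by omega), mul_zero, add_zero]

theorem treeWalkCount_eq_zero_of_odd (k : ℕ) {i j : ℕ} (hij : Odd (i + j)) :
    treeWalkCount k i j = 0 := by
  induction i generalizing j with
  | zero => obtain ⟨j, rfl⟩ := Nat.exists_eq_add_one.2 (zero_add j ▸ hij.pos); rfl
  | succ i ih =>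
    rcases j with _ | j
    · rw [treeWalkCount, ih (by simpa using hij), mul_zero]
    · rw [treeWalkCount, ih (by grind), ih (by grind), mul_zero, add_zero]

variable {V : Type*} [Fintype V] [DecidableEq V] {G : SimpleGraph V} [DecidableRel G.Adj] {k : ℕ}

theorem adjMatrix_pow_eq_sum_nbMatrix (hk : G.IsRegularOfDegree k) (i : ℕ) :
    G.adjMatrix ℕ ^ i = ∑ j ∈ range (i + 1), treeWalkCount k i j • nbMatrix G j := by
  induction i with
  | zero => rw [pow_zero, zero_add, sum_range_one, treeWalkCount, one_smul, nbMatrix_zero]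
  | succ i ih =>
    set A := G.adjMatrix ℕ
    set t := treeWalkCount k i
    set N := nbMatrix G
    have ht1 : t (i + 1) = 0 := treeWalkCount_eq_zero_of_lt k (by omega)
    have ht2 : t (i + 2) = 0 := treeWalkCount_eq_zero_of_lt k (by omega)
    have hpow : A ^ i = ∑ j ∈ range (i + 3), t j • N j := by
      rw [sum_range_succ, sum_range_succ, ht1, ht2, zero_smul, zero_smul, add_zero, add_zero, ih]
    have hshift : ∑ j ∈ range (i + 1), t j • N (j + 1) =
        ∑ j ∈ range (i + 1), t (j + 2) • N (j + 3) + t 1 • N 2 + t 0 • N 1 := by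
      rw [← sum_range_succ' (fun j => t (j + 1) • N (j + 2)),
        ← sum_range_succ' (fun j => t j • N (j + 1)), sum_range_succ _ (i + 2),
        sum_range_succ _ (i + 1), ht1, ht2, zero_smul, zero_smul, add_zero, add_zero]
    calc A ^ (i + 1) = ∑ j ∈ range (i + 3), t j • (A * N j) := by
          rw [pow_succ', hpow, Matrix.mul_sum]
          exact sum_congr rfl fun j _ => Matrix.mul_smul _ _ _
      _ = ∑ j ∈ range (i + 1), t (j + 2) • (N (j + 3) + (k - 1) • N (j + 1)) +
            t 1 • (N 2 + k • N 0) + t 0 • N 1 := by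
          rw [sum_range_succ', sum_range_succ']
          simp only [adjMatrix_mul_nbMatrix_zero, zero_add, adjMatrix_mul_nbMatrix_one hk,
            add_assoc, Nat.reduceAdd, adjMatrix_mul_nbMatrix_add_two hk, A, N]
      _ = ∑ j ∈ range (i + 1), (t j + (k - 1) * t (j + 2)) • N (j + 1) + (k * t 1) • N 0 := by
          simp only [smul_add, add_smul, sum_add_distrib, hshift, smul_smul, mul_comm]
          abel
      _ = ∑ j ∈ range (i + 2), treeWalkCount k (i + 1) j • N j :=
          (sum_range_succ' (fun j => treeWalkCount k (i + 1) j • N j) (i + 1)).symm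

end TreeWalkCount

section ClosedWalk

variable {V : Type*} {G : SimpleGraph V} {l : ℕ}

/-- The number of closed walks of length `l` from `v` to itself which run once around a cycle, so
that each cycle through `v` is counted once for each of its two orientations. -/
noncomputable def cycleWalkCount (G : SimpleGraph V) (v : V) (l : ℕ) : ℕ :=
  {p : G.Walk v v | p.length = l ∧ p.IsCycle}.ncard

theorem cycleWalkCount_eq_zero_of_lt_egirth (hl : (l : ℕ∞) < G.egirth) (v : V) :
    cycleWalkCount G v l = 0 := by
  have hempty : {p : G.Walk v v | p.length = l ∧ p.IsCycle} = ∅ := by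
    refine Set.eq_empty_of_forall_notMem ?_
    rintro p ⟨rfl, hp⟩
    exact hl.not_ge (by simpa using egirth_le_length hp)
  rw [cycleWalkCount, hempty, Set.ncard_empty]

theorem nbMatrix_apply_self (hl : (l : ℕ∞) ≤ G.egirth) (v : V) :
    nbMatrix G l v v = (if l = 0 then 1 else 0) + cycleWalkCount G v l := by
  classical
  split_ifs with hl0
  · subst hl0
    have hpos : ((0 : ℕ) : ℕ∞) < G.egirth := lt_of_lt_of_le (by norm_num) three_le_egirth
    rw [nbMatrix_zero, Matrix.one_apply_eq, cycleWalkCount_eq_zero_of_lt_egirth hpos,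
      add_zero]
  · rw [zero_add]
    refine congrArg Set.ncard (Set.ext fun p => and_congr_right ?_)
    rintro rfl
    exact isNonBacktracking_iff_isCycle hl (mt Walk.length_eq_zero_iff.2 hl0)

variable [Fintype V] [DecidableRel G.Adj]

theorem adjMatrix_pow_apply_eq_ncard_walk [DecidableEq V] (l : ℕ) (u v : V) :
    (G.adjMatrix ℕ ^ l) u v = {p : G.Walk u v | p.length = l}.ncard := by
  rw [adjMatrix_pow_apply_eq_card_walk, ← Nat.card_coe_set_eq, Nat.card_eq_fintype_card]
  simp

theorem c_add_cycleWalkCount [DecidableEq V] (hl : (l : ℕ∞) ≤ G.egirth) (v : V) :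
    c G v l + cycleWalkCount G v l = (G.adjMatrix ℕ ^ l) v v := by
  have hcycle : {p : G.Walk v v | p.length = l ∧ p.IsCycle} = {p : G.Walk v v | p.length = l} \
      {p | p.length = l ∧ (fromEdgeSet {e | e ∈ p.edges}).IsAcyclic} := by
    ext p
    simp only [Set.mem_sdiff, Set.mem_ofPred_eq, not_and]
    constructor
    · rintro ⟨rfl, hp⟩
      exact ⟨rfl, fun _ => (isCycle_iff_not_isAcyclic hl).1 hp⟩
    · rintro ⟨rfl, hp⟩
      exact ⟨rfl, (isCycle_iff_not_isAcyclic hl).2 (hp rfl)⟩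
  rw [adjMatrix_pow_apply_eq_ncard_walk, cycleWalkCount, hcycle, add_comm, c,
    Set.ncard_sdiff_add_ncard_of_subset (fun _ hp => hp.1) (finite_setOf_length_eq v v l)]

theorem adjMatrix_pow_apply_self [DecidableEq V] {k : ℕ} (hk : G.IsRegularOfDegree k)
    (hl : (l : ℕ∞) ≤ G.egirth) (v : V) :
    (G.adjMatrix ℕ ^ l) v v = treeWalkCount k l 0 + cycleWalkCount G v l := by
  have hlast : ∑ j ∈ range (l + 1), treeWalkCount k l j * cycleWalkCount G v j =
      cycleWalkCount G v l := by
    rw [sum_range_succ, treeWalkCount_self, one_mul, Nat.add_eq_right]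
    refine sum_eq_zero fun j hj => ?_
    have hlt : (j : ℕ∞) < G.egirth := lt_of_lt_of_le (by exact_mod_cast mem_range.1 hj) hl
    rw [cycleWalkCount_eq_zero_of_lt_egirth hlt, mul_zero]
  calc (G.adjMatrix ℕ ^ l) v v
      = ∑ j ∈ range (l + 1), treeWalkCount k l j * nbMatrix G j v v := by
        simp only [adjMatrix_pow_eq_sum_nbMatrix hk, Matrix.sum_apply, Matrix.smul_apply,
          smul_eq_mul]
    _ = ∑ j ∈ range (l + 1),
          treeWalkCount k l j * ((if j = 0 then 1 else 0) + cycleWalkCount G v j) := by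
        refine sum_congr rfl fun j hj => ?_
        have hle : (j : ℕ∞) ≤ l := by exact_mod_cast mem_range_succ_iff.1 hj
        rw [nbMatrix_apply_self (hle.trans hl)]
    _ = treeWalkCount k l 0 + cycleWalkCount G v l := by
        simp only [mul_add, sum_add_distrib, hlast, mul_ite, mul_one, mul_zero, sum_ite_eq',
          mem_range, Nat.succ_pos, if_true]

theorem c_eq_treeWalkCount {k : ℕ} (hk : G.IsRegularOfDegree k) (hl : (l : ℕ∞) ≤ G.egirth)
    (v : V) : c G v l = treeWalkCount k l 0 := by
  classical
  exact Nat.add_right_cancel ((c_add_cycleWalkCount hl v).trans (adjMatrix_pow_apply_self hk hl v))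

end ClosedWalk

theorem sq_sum_sub_apply_le {ι R : Type*} [CommRing R] [LinearOrder R] [IsStrictOrderedRing R]
    {s : Finset ι} {i : ι} (hi : i ∈ s) (f : ι → R) :
    (∑ j ∈ s, f j - f i) ^ 2 ≤ (#s - 1) * (∑ j ∈ s, f j ^ 2 - f i ^ 2) := by
  classical
  have hcs := sq_sum_le_card_mul_sum_sq (s := s.erase i) (f := f)
  rwa [sum_erase_eq_sub hi, sum_erase_eq_sub hi, card_erase_of_mem hi,
    Nat.cast_pred (card_pos.2 ⟨i, hi⟩)] at hcs

section WalkCount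

variable {V : Type*} [Fintype V] [DecidableEq V] {G : SimpleGraph V} [DecidableRel G.Adj] {k : ℕ}

theorem adjMatrix_pow_succ_apply (l : ℕ) (u v : V) :
    (G.adjMatrix ℕ ^ (l + 1)) u v = ∑ w ∈ G.neighborFinset u, (G.adjMatrix ℕ ^ l) w v := by
  rw [pow_succ', adjMatrix_mul_apply]

theorem sum_adjMatrix_pow_apply (hk : G.IsRegularOfDegree k) (l : ℕ) (v : V) :
    ∑ w, (G.adjMatrix ℕ ^ l) v w = k ^ l := by
  induction l generalizing v with
  | zero => simp [Matrix.one_apply]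
  | succ l ih =>
    simp only [adjMatrix_pow_succ_apply]
    rw [sum_comm, sum_congr rfl fun w _ => ih w, sum_const, card_neighborFinset_eq_degree, hk v,
      smul_eq_mul, pow_succ']

theorem adjMatrix_pow_succ_apply_le (hk : G.IsRegularOfDegree k) (l : ℕ) (u v : V) :
    (G.adjMatrix ℕ ^ (l + 1)) u v ≤ k ^ l := by
  induction l generalizing u with
  | zero =>
    rw [zero_add, pow_one, pow_zero, adjMatrix_apply]
    split_ifs <;> simp
  | succ l ih =>
    rw [adjMatrix_pow_succ_apply]
    refine (sum_le_card_nsmul _ _ _ fun w _ => ih w).trans_eq ?_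
    rw [card_neighborFinset_eq_degree, hk u, smul_eq_mul, pow_succ']

theorem sum_sq_adjMatrix_pow_apply (l : ℕ) (v : V) :
    ∑ w, (G.adjMatrix ℕ ^ l) v w ^ 2 = (G.adjMatrix ℕ ^ (l + l)) v v := by
  rw [pow_add, Matrix.mul_apply]
  refine sum_congr rfl fun w _ => ?_
  rw [sq, ((G.isSymm_adjMatrix (α := ℕ)).pow l).apply v w]

theorem sum_adjMatrix_pow_apply_of_support (hk : G.IsRegularOfDegree k) {l : ℕ} {v : V}
    {s : Finset V} (hs : ∀ w, (G.adjMatrix ℕ ^ l) v w ≠ 0 → w ∈ s) :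
    ∑ w ∈ s, (G.adjMatrix ℕ ^ l) v w = k ^ l := by
  rw [← sum_adjMatrix_pow_apply hk l v]
  exact sum_subset s.subset_univ fun w _ hw => not_not.1 (mt (hs w) hw)

theorem sum_sq_adjMatrix_pow_apply_of_support {l : ℕ} {v : V} {s : Finset V}
    (hs : ∀ w, (G.adjMatrix ℕ ^ l) v w ≠ 0 → w ∈ s) :
    ∑ w ∈ s, (G.adjMatrix ℕ ^ l) v w ^ 2 = (G.adjMatrix ℕ ^ (l + l)) v v := by
  rw [← sum_sq_adjMatrix_pow_apply]
  exact sum_subset s.subset_univ fun w _ hw => pow_eq_zero_iff two_ne_zero |>.2 <|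
    not_not.1 (mt (hs w) hw)

theorem pow_le_card_mul_adjMatrix_pow (hk : G.IsRegularOfDegree k) {l : ℕ} {v : V}
    {s : Finset V} (hs : ∀ w, (G.adjMatrix ℕ ^ l) v w ≠ 0 → w ∈ s) :
    k ^ (l + l) ≤ #s * (G.adjMatrix ℕ ^ (l + l)) v v := by
  have hcs := sq_sum_le_card_mul_sum_sq (s := s) (f := fun w => (G.adjMatrix ℕ ^ l) v w)
  rwa [sum_adjMatrix_pow_apply_of_support hk hs, sum_sq_adjMatrix_pow_apply_of_support hs, sq,
    ← pow_add] at hcs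

theorem sq_pow_sub_adjMatrix_pow_le (hk : G.IsRegularOfDegree k) {l : ℕ} {v : V} {s : Finset V}
    (hs : ∀ w, (G.adjMatrix ℕ ^ l) v w ≠ 0 → w ∈ s) (hv : v ∈ s) :
    ((k : ℝ) ^ l - (G.adjMatrix ℕ ^ l) v v) ^ 2 ≤
      (#s - 1) * ((G.adjMatrix ℕ ^ (l + l)) v v - ((G.adjMatrix ℕ ^ l) v v : ℝ) ^ 2) := by
  have hcs := sq_sum_sub_apply_le hv fun w => ((G.adjMatrix ℕ ^ l) v w : ℝ)
  have hsum : ∑ w ∈ s, ((G.adjMatrix ℕ ^ l) v w : ℝ) = k ^ l := by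
    exact_mod_cast sum_adjMatrix_pow_apply_of_support hk hs
  have hsq : ∑ w ∈ s, ((G.adjMatrix ℕ ^ l) v w : ℝ) ^ 2 = (G.adjMatrix ℕ ^ (l + l)) v v := by
    exact_mod_cast sum_sq_adjMatrix_pow_apply_of_support hs
  rwa [hsum, hsq] at hcs

theorem sq_adjMatrix_pow_apply_self_lt (hk : G.IsRegularOfDegree k) (hk2 : 2 ≤ k) (hl : l ≠ 0)
    (v : V) : (G.adjMatrix ℕ ^ l) v v ^ 2 < (G.adjMatrix ℕ ^ (l + l)) v v := by
  obtain ⟨m, rfl⟩ := Nat.exists_eq_add_one_of_ne_zero hl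
  have hlt : (G.adjMatrix ℕ ^ (m + 1)) v v < k ^ (m + 1) :=
    (adjMatrix_pow_succ_apply_le hk m v v).trans_lt (Nat.pow_lt_pow_right hk2 m.lt_succ_self)
  have hpos : (0 : ℝ) < ((k : ℝ) ^ (m + 1) - (G.adjMatrix ℕ ^ (m + 1)) v v) ^ 2 :=
    pow_pos (sub_pos.2 (by exact_mod_cast hlt)) 2
  have hprod := hpos.trans_le (sq_pow_sub_adjMatrix_pow_le hk (fun w _ => mem_univ w) (mem_univ v))
  have hcard : (0 : ℝ) ≤ #(univ : Finset V) - 1 :=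
    sub_nonneg.2 (by exact_mod_cast card_pos.2 ⟨v, mem_univ v⟩)
  exact_mod_cast sub_pos.1 (pos_of_mul_pos_right hprod hcard)

end WalkCount

section Bipartite

variable {V : Type*} [Fintype V] {G : SimpleGraph V} [DecidableRel G.Adj] {k : ℕ}

theorem two_mul_card_colorClass (hk : G.IsRegularOfDegree k) (hk0 : k ≠ 0)
    (col : G.Coloring Bool) (b : Bool) : 2 * #{w | col w = b} = Fintype.card V := by
  have hbip : G.IsBipartiteWith ({w | col w = b} : Finset V) ({w | ¬ col w = b} : Finset V) := by
    refine ⟨disjoint_coe.2 (disjoint_filter_filter_not _ _ _), fun v w hvw => ?_⟩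
    have hne : col v = !col w := Bool.eq_not.2 (col.valid hvw)
    cases b <;> simp [hne]
  have hdeg := isBipartiteWith_sum_degrees_eq hbip
  simp only [hk.degree_eq, sum_const, smul_eq_mul] at hdeg
  rw [two_mul, ← card_univ, ← card_filter_add_card_filter_not (s := univ) fun w => col w = b]
  exact congrArg _ (Nat.eq_of_mul_eq_mul_right (Nat.pos_of_ne_zero hk0) hdeg)

theorem exists_support_adjMatrix_pow_of_isBipartite [DecidableEq V] (hb : G.IsBipartite)
    (hk : G.IsRegularOfDegree k) (hk0 : k ≠ 0) (l : ℕ) (v : V) :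
    ∃ s : Finset V, 2 * #s = Fintype.card V ∧ (∀ w, (G.adjMatrix ℕ ^ l) v w ≠ 0 → w ∈ s) ∧
      (Even l → v ∈ s) := by
  let col : G.Coloring Bool := hb.toColoring (by simp)
  let b : Bool := if Even l then col v else !col v
  refine ⟨({w | col w = b} : Finset V), two_mul_card_colorClass hk hk0 col b, fun w hw => ?_,
    fun hl => by simp [b, hl]⟩
  rw [adjMatrix_pow_apply_eq_ncard_walk] at hw
  obtain ⟨p, rfl⟩ := Set.nonempty_of_ncard_ne_zero hw
  have hp := col.even_length_iff_congr p
  rw [mem_filter_univ]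
  cases hcv : col v <;> cases hcw : col w <;> simp_all [b]

end Bipartite

namespace IsEGR

variable {V : Type*} [Fintype V] {G : SimpleGraph V} [DecidableRel G.Adj] {n k g l lam : ℕ}

theorem exists_isCycle (hG : IsEGR G n k g lam) :
    ∃ (v : V) (p : G.Walk v v), p.IsCycle ∧ p.length = g := by
  have hcyc : ¬ G.IsAcyclic := by
    rw [← egirth_eq_top, hG.girth]
    exact ENat.natCast_ne_top g
  obtain ⟨v, p, hp, hlen⟩ := exists_egirth_eq_length.2 hcyc
  exact ⟨v, p, hp, by exact_mod_cast hlen.symm.trans hG.girth⟩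

theorem three_le (hG : IsEGR G n k g lam) : 3 ≤ g := by
  obtain ⟨v, p, hp, rfl⟩ := hG.exists_isCycle
  exact hp.three_le_length

theorem two_le (hG : IsEGR G n k g lam) : 2 ≤ k := by
  obtain ⟨v, p, hp, -⟩ := hG.exists_isCycle
  rw [← hG.regular v, ← card_neighborFinset_eq_degree, ← hp.ncard_neighborSet_toSubgraph_eq_two
    p.start_mem_support, ← Set.ncard_coe_finset, coe_neighborFinset]
  exact Set.ncard_le_ncard (p.toSubgraph.neighborSet_subset v) (Set.toFinite _)

theorem nonempty (hG : IsEGR G n k g lam) : Nonempty V :=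
  let ⟨v, _⟩ := hG.exists_isCycle
  ⟨v⟩

theorem cycleWalkCount_eq (hG : IsEGR G n k g lam) (v : V) :
    cycleWalkCount G v g = k * lam := by
  obtain ⟨m, rfl⟩ := Nat.exists_eq_add_of_le' (Nat.one_le_of_lt hG.three_le)
  have hcons (x : V) (h : G.Adj v x) :
      {p : G.Walk x v | p.length = m ∧ (p.cons h).IsCycle}.ncard = lam :=
    (ncard_isCycle_cons h m).trans (hG.cycles s(v, x) h)
  rw [cycleWalkCount, ncard_walk_succ m hcons, sum_const, card_neighborFinset_eq_degree,
    hG.regular v, smul_eq_mul]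

theorem adjMatrix_pow_girth_apply_self [DecidableEq V] (hG : IsEGR G n k g lam) (v : V) :
    (G.adjMatrix ℕ ^ g) v v = treeWalkCount k g 0 + k * lam := by
  rw [adjMatrix_pow_apply_self hG.regular hG.girth.ge, hG.cycleWalkCount_eq]

theorem c_eq_treeWalkCount (hG : IsEGR G n k g lam) (hl : l ≤ g) (v : V) :
    c G v l = treeWalkCount k l 0 :=
  EdgeGirthRegular.c_eq_treeWalkCount hG.regular (hG.girth ▸ Nat.cast_le.2 hl) v

theorem adjMatrix_pow_apply_self_of_lt [DecidableEq V] (hG : IsEGR G n k g lam) (hl : l < g)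
    (v : V) : (G.adjMatrix ℕ ^ l) v v = treeWalkCount k l 0 := by
  have hlt : (l : ℕ∞) < G.egirth := hG.girth ▸ Nat.cast_lt.2 hl
  rw [adjMatrix_pow_apply_self hG.regular hlt.le, cycleWalkCount_eq_zero_of_lt_egirth hlt,
    add_zero]

theorem sq_treeWalkCount_lt (hG : IsEGR G n k (l + l) lam) :
    treeWalkCount k l 0 ^ 2 < treeWalkCount k (l + l) 0 + k * lam := by
  classical
  obtain ⟨v⟩ := hG.nonempty
  have hl : l ≠ 0 := by have := hG.three_le; omega
  have hlt := sq_adjMatrix_pow_apply_self_lt hG.regular hG.two_le hl v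
  rwa [hG.adjMatrix_pow_apply_self_of_lt (by omega), hG.adjMatrix_pow_girth_apply_self] at hlt

theorem bound_of_support [DecidableEq V] (hG : IsEGR G n k (l + l) lam) {v : V} {s : Finset V}
    (hs : ∀ w, (G.adjMatrix ℕ ^ l) v w ≠ 0 → w ∈ s) (hv : v ∈ s) :
    (treeWalkCount k (l + l) 0 : ℝ) + k * lam + k ^ (l + l) - 2 * treeWalkCount k l 0 * k ^ l ≤
      #s * (treeWalkCount k (l + l) 0 - (treeWalkCount k l 0 : ℝ) ^ 2 + k * lam) := by
  have hlt : l < l + l := by have := hG.three_le; omega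
  have hcs := sq_pow_sub_adjMatrix_pow_le hG.regular hs hv
  rw [hG.adjMatrix_pow_apply_self_of_lt hlt, hG.adjMatrix_pow_girth_apply_self] at hcs
  push_cast at hcs
  rw [pow_add]
  linarith

theorem order_bound (hG : IsEGR G n k (l + l) lam) :
    (treeWalkCount k (l + l) 0 : ℝ) + k * lam + k ^ (l + l) - 2 * treeWalkCount k l 0 * k ^ l ≤
      n * (treeWalkCount k (l + l) 0 - (treeWalkCount k l 0 : ℝ) ^ 2 + k * lam) := by
  classical
  obtain ⟨v⟩ := hG.nonempty
  have hbound := hG.bound_of_support (fun w _ => mem_univ w) (mem_univ v)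
  rwa [card_univ, hG.order] at hbound

theorem bipartite_order_bound_of_even (hG : IsEGR G n k (l + l) lam) (hb : G.IsBipartite)
    (hl : Even l) :
    2 * ((treeWalkCount k (l + l) 0 : ℝ) + k * lam + k ^ (l + l) -
        2 * treeWalkCount k l 0 * k ^ l) ≤
      n * (treeWalkCount k (l + l) 0 - (treeWalkCount k l 0 : ℝ) ^ 2 + k * lam) := by
  classical
  obtain ⟨v⟩ := hG.nonempty
  obtain ⟨s, hcard, hs, hv⟩ := exists_support_adjMatrix_pow_of_isBipartite hb hG.regular
    (Nat.ne_zero_of_lt hG.two_le) l v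
  rw [← hG.order, ← hcard, Nat.cast_mul, Nat.cast_two, mul_assoc (2 : ℝ) (#s : ℝ)]
  exact mul_le_mul_of_nonneg_left (hG.bound_of_support hs (hv hl)) zero_le_two

theorem bipartite_order_bound (hG : IsEGR G n k (l + l) lam) (hb : G.IsBipartite) :
    2 * k ^ (l + l) ≤ n * (treeWalkCount k (l + l) 0 + k * lam) := by
  classical
  obtain ⟨v⟩ := hG.nonempty
  obtain ⟨s, hcard, hs, -⟩ := exists_support_adjMatrix_pow_of_isBipartite hb hG.regular
    (Nat.ne_zero_of_lt hG.two_le) l v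
  rw [← hG.order, ← hcard, mul_assoc, ← hG.adjMatrix_pow_girth_apply_self v]
  exact Nat.mul_le_mul_left 2 (pow_le_card_mul_adjMatrix_pow hG.regular hs)

end IsEGR

section Iso

variable {V W : Type*} {G : SimpleGraph V} {G' : SimpleGraph W}

theorem IsCycleSubgraph.map {g : ℕ} {H : G.Subgraph} (hH : IsCycleSubgraph G g H) {f : G →g G'}
    (hf : Function.Injective f) : IsCycleSubgraph G' g (H.map f) := by
  obtain ⟨v, p, hp, rfl, rfl⟩ := hH
  exact ⟨f v, p.map f, hp.map hf, p.length_map f, p.toSubgraph_map f⟩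

theorem subgraph_map_symm_map (φ : G ≃g G') (H : G.Subgraph) :
    (H.map φ.toHom).map φ.symm.toHom = H := by
  have hcomp : φ.symm.toHom.comp φ.toHom = Hom.id := RelHom.ext φ.symm_apply_apply
  rw [← Subgraph.map_comp, hcomp, Subgraph.map_id]

theorem ncard_isCycleSubgraph_map (φ : G ≃g G') (g : ℕ) (e : Sym2 V) :
    {H : G'.Subgraph | IsCycleSubgraph G' g H ∧ e.map φ ∈ H.edgeSet}.ncard =
      {H : G.Subgraph | IsCycleSubgraph G g H ∧ e ∈ H.edgeSet}.ncard := by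
  have hmem (H : G.Subgraph) : e.map φ ∈ (H.map φ.toHom).edgeSet ↔ e ∈ H.edgeSet := by
    rw [Subgraph.edgeSet_map]
    exact (Sym2.map.injective φ.injective).mem_set_image
  symm
  refine Set.ncard_congr (fun H _ => H.map φ.toHom) ?_ ?_ ?_
  · exact fun H hH => ⟨hH.1.map φ.injective, (hmem H).2 hH.2⟩
  · exact fun H H' _ _ heq => (Function.LeftInverse.injective (subgraph_map_symm_map φ)) heq
  · intro H hH
    have hH' : (H.map φ.symm.toHom).map φ.toHom = H := subgraph_map_symm_map φ.symm H
    exact ⟨H.map φ.symm.toHom, ⟨hH.1.map φ.symm.injective, (hmem _).1 (hH'.symm ▸ hH.2)⟩, hH'⟩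

variable [Fintype V] [DecidableRel G.Adj] {n k g lam : ℕ}

theorem IsEGR.of_iso [Fintype W] [DecidableRel G'.Adj] (hG : IsEGR G n k g lam) (φ : G ≃g G') :
    IsEGR G' n k g lam where
  order := (Fintype.card_congr φ.toEquiv).symm.trans hG.order
  regular w := (φ.symm.degree_eq w).symm.trans (hG.regular _)
  girth := φ.egirth_eq.symm.trans hG.girth
  cycles e he := by
    obtain ⟨e, rfl⟩ : ∃ e' : Sym2 V, e'.map φ = e := e.inductionOn fun x y =>
      ⟨s(φ.symm x, φ.symm y), by simp⟩
    rw [ncard_isCycleSubgraph_map φ]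
    refine hG.cycles e ?_
    induction e with
    | h x y => exact φ.map_adj_iff.1 he

theorem IsEGR.mem_orders (hG : IsEGR G n k g lam) : n ∈ orders k g lam := by
  classical
  exact ⟨G.overFin hG.order, inferInstance, hG.of_iso (G.overFinIso hG.order)⟩

end Iso

end EdgeGirthRegular

open EdgeGirthRegular in
theorem mainTheorem1 {V : Type u} [Fintype V] (G : SimpleGraph V) [DecidableRel G.Adj]
    (n k g lam : ℕ) (hG : IsEGR G n k g lam) (hg : Even g) (v : V) :
    (g % 4 = 0 →
      0 < (c G v g : ℝ) - (c G v (g / 2) : ℝ) ^ 2 + k * lam ∧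
      ((c G v g : ℝ) + k * lam + (k : ℝ) ^ g - 2 * c G v (g / 2) * (k : ℝ) ^ (g / 2)) /
          ((c G v g : ℝ) - (c G v (g / 2) : ℝ) ^ 2 + k * lam)
        ≤ (minOrder k g lam : ℝ) ∧
      ((bipartiteOrders k g lam).Nonempty →
        2 * (((c G v g : ℝ) + k * lam + (k : ℝ) ^ g - 2 * c G v (g / 2) * (k : ℝ) ^ (g / 2)) /
            ((c G v g : ℝ) - (c G v (g / 2) : ℝ) ^ 2 + k * lam))
          ≤ (minBipartiteOrder k g lam : ℝ))) ∧
    (g % 4 = 2 →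
      0 < (c G v g : ℝ) + k * lam ∧
      ((c G v g : ℝ) + k * lam + (k : ℝ) ^ g) / ((c G v g : ℝ) + k * lam)
        ≤ (minOrder k g lam : ℝ) ∧
      ((bipartiteOrders k g lam).Nonempty →
        2 * (k : ℝ) ^ g / ((c G v g : ℝ) + k * lam) ≤ (minBipartiteOrder k g lam : ℝ))) := by
  obtain ⟨l, rfl⟩ := hg
  obtain ⟨H, _, hH⟩ : minOrder k (l + l) lam ∈ orders k (l + l) lam :=
    Nat.sInf_mem ⟨n, hG.mem_orders⟩
  have hbound := hH.order_bound
  rw [show (l + l) / 2 = l by omega, hG.c_eq_treeWalkCount le_rfl,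
    hG.c_eq_treeWalkCount (Nat.le_add_left l l)]
  have hpos : (0 : ℝ) < treeWalkCount k (l + l) 0 - treeWalkCount k l 0 ^ 2 + k * lam := by
    have : (treeWalkCount k l 0 ^ 2 : ℝ) < treeWalkCount k (l + l) 0 + k * lam := by
      exact_mod_cast hG.sq_treeWalkCount_lt
    linarith
  refine ⟨fun h4 => ⟨hpos, (div_le_iff₀ hpos).2 hbound, fun hne => ?_⟩, fun h4 => ?_⟩
  · obtain ⟨H', _, hH', hb⟩ := Nat.sInf_mem hne
    rw [← mul_div_assoc, div_le_iff₀ hpos]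
    exact hH'.bipartite_order_bound_of_even hb (Nat.even_iff.2 (by omega))
  · have hzero : treeWalkCount k l 0 = 0 :=
      treeWalkCount_eq_zero_of_odd k (Nat.odd_iff.2 (by omega))
    simp only [hzero, Nat.cast_zero, mul_zero, zero_mul, sub_zero, zero_pow two_ne_zero]
      at hpos hbound
    refine ⟨hpos, (div_le_iff₀ hpos).2 hbound, fun hne => (div_le_iff₀ hpos).2 ?_⟩
    obtain ⟨H', _, hH', hb⟩ := Nat.sInf_mem hne
    exact_mod_cast hH'.bipartite_order_bound hb
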